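/- Let $A$ be a finite alphabet. The atomic operations are: write a letter $a\in A$, the backspace $\leftarrow$, the left arrow $\blacktriangleleft$ and the right arrow $\blacktriangleright$. They act on configurations $(u,v)\in A^*\times A^*$ (text to the left and to the right of the cursor) by $(u,v)\cdot a=(ua,v)$, $(u'a,v)\cdot{\leftarrow}=(u',v)$, $(u'a,v)\cdot{\blacktriangleleft}=(u',av)$, $(u,av')\cdot{\blacktriangleright}=(ua,v')$; backspace and left arrow have no effect if $u=\epsilon$, and right arrow has no effect if $v=\epsilon$. A key is a finite sequence of atomic operations, applied from left to right. A keyboard is a pair $K=(T,F)$ of finite sets of keys, and its language $L(K)\subseteq A^*$ is the set of words $uv$ such that $(u,v)=(\epsilon,\epsilon)\cdot t_1\cdots t_n t_f$ for some $n\ge 0$, $t_1,\dots,t_n\in T$ and $t_f\in F$. The class $\mathsf{BLEK}$ consists of the keyboards none of whose keys contains $\blacktriangleright$. A pushdown automaton has finite sets of states and of stack symbols, an initial stack symbol $\bot$, sets of initial and final states, and finitely many transitions, each of which reads at most one letter, then pops at most one stack symbol, then pushes at most one stack symbol; it starts in an initial state with stack $\bot$ and accepts in a final state with empty stack. Theorem.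 For every keyboard $K$ in $\mathsf{BLEK}$, the language $L(K)$ is context-free. Moreover, there is a polynomial-time algorithm (a Turing machine, for the fixed alphabet $A$) which, given a list of the keys in $T$ and a list of the keys in $F$ for a keyboard $K=(T,F)$ in $\mathsf{BLEK}$, outputs a nondeterministic pushdown automaton recognizing $L(K)$. -/

import Mathlib

namespace KeyboardLang

/-! ### Keyboards -/

/-- Atomic operations over the alphabet `A`: writing a letter, backspace, left arrow, right arrow. -/
inductive Op (A : Type) where
  | write (a : A)
  | backspace
  | left
  | right

/-- A configuration `(u, v)`: the text to the left and the text to the right of the cursor, both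
in reading order. -/
abbrev Config (A : Type) := List A × List A

/-- A key is a finite sequence of atomic operations. -/
abbrev Key (A : Type) := List (Op A)

variable {A : Type}

/-- The action of an atomic operation on a configuration. Backspace and the arrows have no effect
when there is no letter on the relevant side of the cursor. -/
def Config.act : Config A → Op A → Config A
  | (u, v), .write a => (u ++ [a], v)
  | (u, v), .backspace => (u.dropLast, v)
  | (u, v), .left =>
    match u.getLast? with
    | none => (u, v)
    | some a => (u.dropLast, a :: v)
  | (u, []), .right => (u, [])
  | (u, a :: v), .right => (u ++ [a], v)

/-- The action of a key: its operations are applied from left to right. -/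
def Config.actKey (c : Config A) (t : Key A) : Config A := t.foldl Config.act c

/-- The action of a sequence of keys. -/
def Config.actKeys (c : Config A) (τ : List (Key A)) : Config A := τ.foldl Config.actKey c

/-- A keyboard (with entry): a finite set of transient keys and a finite set of final keys. -/
structure Keyboard (A : Type) where
  transient : Finset (Key A)
  final : Finset (Key A)

/-- The language of a keyboard: the words `u v` such that `(u, v)` is reached from the empty
configuration by a (possibly empty) sequence of transient keys followed by one final key. -/
def Keyboard.language (K : Keyboard A) : Language A :=
  {w | ∃ τ : List (Key A), (∀ t ∈ τ, t ∈ K.transient) ∧ ∃ f ∈ K.final, ∃ u v : List A,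
    Config.actKeys ([], []) (τ ++ [f]) = (u, v) ∧ w = u ++ v}

/-- The class `BLEK`: backspace, left arrow and entry are allowed, the right arrow is not. -/
def Keyboard.IsBLEK (K : Keyboard A) : Prop :=
  (∀ t ∈ K.transient, Op.right ∉ t) ∧ (∀ t ∈ K.final, Op.right ∉ t)

/-! ### Nondeterministic pushdown automata -/

/-- A transition from `src` to `tgt` that reads `read`, pops `pop` and then pushes `push`. Here
`none` means: reads nothing (an `ε`-transition), pops nothing, pushes nothing. -/
structure PDATransition (A : Type) (n m : ℕ) where
  src : Fin n
  read : Option A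
  pop : Option (Fin m)
  push : Option (Fin m)
  tgt : Fin n

/-- A nondeterministic pushdown automaton over `A`, given explicitly: its states are
`0, …, numStates - 1` and its stack symbols are `0, …, numSymbols - 1`. -/
structure PDA (A : Type) where
  numStates : ℕ
  numSymbols : ℕ
  bottom : Fin numSymbols
  init : List (Fin numStates)
  final : List (Fin numStates)
  transitions : List (PDATransition A numStates numSymbols)

/-- An instantaneous description: state, input still to be read, stack (top first). -/
structure PDA.ID (P : PDA A) where
  state : Fin P.numStates
  input : List A
  stack : List (Fin P.numSymbols)

/-- One move of the automaton. -/
def PDA.Step (P : PDA A) (c d : P.ID) : Prop :=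
  ∃ t ∈ P.transitions, c.state = t.src ∧ d.state = t.tgt ∧ c.input = t.read.toList ++ d.input ∧
    ∃ r : List (Fin P.numSymbols), c.stack = t.pop.toList ++ r ∧ d.stack = t.push.toList ++ r

/-- The recognized language: acceptance is by final state together with empty stack, starting from
an initial state with only the initial symbol `bottom` on the stack. -/
def PDA.language (P : PDA A) : Language A :=
  {w | ∃ q₀ ∈ P.init, ∃ q ∈ P.final,
    Relation.ReflTransGen P.Step ⟨q₀, w, [P.bottom]⟩ ⟨q, [], []⟩}

/-! ### Keyboards and automata as words, for Turing machines -/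

/-- The keyboard as data: a list of its transient keys and a list of its final keys. -/
abbrev KeyboardListing (A : Type) := List (Key A) × List (Key A)

/-- `x` lists the keys of `K`. -/
def KeyboardListing.Lists (x : KeyboardListing A) (K : Keyboard A) : Prop :=
  (∀ t, t ∈ x.1 ↔ t ∈ K.transient) ∧ (∀ t, t ∈ x.2 ↔ t ∈ K.final)

/-- The symbols with which keyboards are written down. -/
inductive KeyboardSym (A : Type) where
  | op (o : Op A)
  | endKey
  | sep

/-- A key is written as its operations followed by an end mark. -/
def encodeKey (t : Key A) : List (KeyboardSym A) := t.map .op ++ [.endKey]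

/-- A keyboard is written as its transient keys, a separator, and its final keys. Its length is
one plus the sum of `|t| + 1` over all listed keys `t`. -/
def encodeKeyboard (x : KeyboardListing A) : List (KeyboardSym A) :=
  x.1.flatMap encodeKey ++ [.sep] ++ x.2.flatMap encodeKey

/-- The symbols with which pushdown automata are written down. -/
inductive PDASym (A : Type) where
  | letter (a : A)
  | one
  | endNum
  | blank
  | item
  | endList

/-- Numbers are written in unary, followed by an end mark. -/
def encodeNum (A : Type) (n : ℕ) : List (PDASym A) := List.replicate n .one ++ [.endNum]

def encodeFin (A : Type) {n : ℕ} (i : Fin n) : List (PDASym A) := encodeNum A i.val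

def encodeRead : Option A → List (PDASym A)
  | none => [.blank]
  | some a => [.letter a]

def encodeStackOp (A : Type) {m : ℕ} : Option (Fin m) → List (PDASym A)
  | none => [.blank]
  | some γ => encodeFin A γ

def encodeTransition {n m : ℕ} (t : PDATransition A n m) : List (PDASym A) :=
  encodeFin A t.src ++ encodeRead t.read ++ encodeStackOp A t.pop ++ encodeStackOp A t.push ++
    encodeFin A t.tgt

/-- A list is written as its entries, each preceded by a mark, followed by an end mark. -/
def encodeList {β : Type} (e : β → List (PDASym A)) (l : List β) : List (PDASym A) :=
  l.flatMap (fun x => .item :: e x) ++ [.endList]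

/-- The full description of a pushdown automaton as a word. -/
def encodePDA (P : PDA A) : List (PDASym A) :=
  encodeNum A P.numStates ++ encodeNum A P.numSymbols ++ encodeFin A P.bottom ++
    encodeList (encodeFin A) P.init ++ encodeList (encodeFin A) P.final ++
    encodeList encodeTransition P.transitions

end KeyboardLang

/-!
The proof runs keyboards backwards. Without the right arrow, the text to the right of the cursor is
only ever extended at its left end, so that the text to the left of the cursor behaves like a stack.
A pushdown automaton that reads a word `u v` first moves `u` from the input to its stack, guessing
where `u` ends, and then undoes a final key and a sequence of transient keys, each from its last
operation to its first: undoing a written letter pops it, undoing a backspace pushes an arbitrary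
letter, and undoing a left arrow moves the next letter of the input to the stack. A backspace or a
left arrow that had no effect is undone by checking that the stack is at its bottom. The automaton
accepts when input and text are both empty between two keys. Its states are the positions in the
written keyboard and three more. This is `undoPDA`. Its correctness, `language_undoPDA`, consists of
an invariant that is preserved when moves are read backwards (`StateMeaning.of_step`) and of a run
that undoes given keystrokes (`le_language_undoPDA`).

Context-freeness follows from the general fact that pushdown automata recognize context-free
languages, `PDA.isContextFree_language`. The nonterminals of the grammar stand for the words that
lead from one state to another while emptying a stack with at most one symbol. Soundness holds
because these languages satisfy the inequations given by the rules, and completeness because a run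
that empties a stack `s₁ ++ s₂` first empties `s₁` (`PDA.Run.split`).

The automaton is written down by a Turing machine with a unary counter for the current position.
Every symbol of the keyboard contributes boundedly many transitions, and these are fixed words apart
from occurrences of the counter. The machine therefore puts a fixed program on a stack for each
symbol it reads, and executes it by writing symbols and copies of the counter. The running time is
bounded in `within_code`.
-/

namespace KeyboardLang

variable {A : Type}

/-! ### Pushdown automata recognize context-free languages -/

namespace PDA

variable (P : PDA A)

/-- `P.Run k c d`: the automaton goes from `c` to `d` in exactly `k` moves. -/
def Run : ℕ → P.ID → P.ID → Prop
  | 0, c, d => c = d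
  | k + 1, c, d => ∃ e, P.Step c e ∧ Run k e d

variable {P}

lemma exists_run_of_reflTransGen {c d : P.ID} (h : Relation.ReflTransGen P.Step c d) :
    ∃ k, P.Run k c d := by
  induction h using Relation.ReflTransGen.head_induction_on with
  | refl => exact ⟨0, rfl⟩
  | head h _ ih =>
    obtain ⟨k, hk⟩ := ih
    exact ⟨k + 1, _, h, hk⟩

/-- A run that empties the stack `s₁ ++ s₂` first empties `s₁` alone. -/
lemma Run.split {q : Fin P.numStates} {k : ℕ} {p : Fin P.numStates} {w : List A}
    {s₁ s₂ : List (Fin P.numSymbols)} (h : P.Run k ⟨p, w, s₁ ++ s₂⟩ ⟨q, [], []⟩) :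
    ∃ r w₁ w₂ k₁ k₂, w = w₁ ++ w₂ ∧ k₁ + k₂ = k ∧
      P.Run k₁ ⟨p, w₁, s₁⟩ ⟨r, [], []⟩ ∧ P.Run k₂ ⟨r, w₂, s₂⟩ ⟨q, [], []⟩ := by
  induction k generalizing p w s₁ with
  | zero =>
    simp only [Run, ID.mk.injEq, List.append_eq_nil_iff] at h
    obtain ⟨rfl, rfl, rfl, rfl⟩ := h
    exact ⟨p, [], [], 0, 0, rfl, rfl, rfl, rfl⟩
  | succ k ih =>
    cases s₁ with
    -- `s₁` counts as emptied before any move is made, even if the run starts by pushing.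
    | nil => exact ⟨p, [], w, 0, k + 1, rfl, by omega, rfl, h⟩
    | cons γ s =>
      obtain ⟨⟨p', w', s'⟩, ⟨t, ht, h1, h2, h3, r, h4, h5⟩, hrun⟩ := h
      simp only at h1 h2 h3 h4 h5
      obtain ⟨r', hr, hr'⟩ : ∃ r', γ :: s = t.pop.toList ++ r' ∧ r = r' ++ s₂ := by
        cases hp : t.pop with
        | none => exact ⟨γ :: s, by simp, by simpa [hp] using h4.symm⟩
        | some δ =>
          simp only [hp, Option.toList_some, List.cons_append, List.nil_append,
            List.cons.injEq] at h4
          exact ⟨s, by simp [h4.1], h4.2.symm⟩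
      rw [hr', ← List.append_assoc] at h5
      rw [h5] at hrun
      obtain ⟨r₁, w₁, w₂, k₁, k₂, rfl, hk, hrun₁, hrun₂⟩ := ih hrun
      refine ⟨r₁, t.read.toList ++ w₁, w₂, k₁ + 1, k₂, by simp [h3], by omega, ?_, hrun₂⟩
      exact ⟨_, ⟨t, ht, h1, h2, rfl, r', hr, rfl⟩, hrun₁⟩

/-- Further letters at the end of the input and further symbols below the stack do not disturb a
run. -/
lemma reflTransGen_append {c d : P.ID} (h : Relation.ReflTransGen P.Step c d) (w : List A)
    (s : List (Fin P.numSymbols)) :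
    Relation.ReflTransGen P.Step ⟨c.state, c.input ++ w, c.stack ++ s⟩
      ⟨d.state, d.input ++ w, d.stack ++ s⟩ := by
  refine h.lift (fun e : P.ID => (⟨e.state, e.input ++ w, e.stack ++ s⟩ : P.ID)) ?_
  rintro a b ⟨t, ht, h1, h2, h3, r, h4, h5⟩
  exact ⟨t, ht, h1, h2, by simp [h3], r ++ s, by simp [h4], by simp [h5]⟩

variable (P)

/-- The words that lead from `p` to `q` while emptying a stack with at most one symbol. -/
def emptying (p : Fin P.numStates) (o : Option (Fin P.numSymbols)) (q : Fin P.numStates) :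
    Language A :=
  {w | Relation.ReflTransGen P.Step ⟨p, w, o.toList⟩ ⟨q, [], []⟩}

/-- The nonterminals of the grammar of `P`: `some (p, o, q)` stands for `P.emptying p o q`, and
`none` is the initial symbol. -/
abbrev GrammarNT := Option (Fin P.numStates × Option (Fin P.numSymbols) × Fin P.numStates)

open Classical in
/-- The rules of the grammar of `P`. The main ones are indexed by a transition `t`: the stack `o`
splits into what `t` pops and a rest `o'`, and after `t` the automaton first empties what `t` has
pushed, then the rest. -/
noncomputable def grammarRules : Finset (ContextFreeRule A P.GrammarNT) :=
  (P.init.toFinset ×ˢ P.final.toFinset).image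
      (fun x => ⟨none, [.nonterminal (some (x.1, some P.bottom, x.2))]⟩) ∪
    Finset.univ.image (fun q => ⟨some (q, none, q), []⟩) ∪
    ((P.transitions.toFinset ×ˢ (Finset.univ : Finset (Option (Fin P.numSymbols) ×
        Option (Fin P.numSymbols) × Fin P.numStates × Fin P.numStates))).filter
      (fun x => x.2.1.toList = x.1.pop.toList ++ x.2.2.1.toList)).image
      (fun x => ⟨some (x.1.src, x.2.1, x.2.2.2.2), x.1.read.toList.map .terminal ++
        [.nonterminal (some (x.1.tgt, x.1.push, x.2.2.2.1)),
          .nonterminal (some (x.2.2.2.1, x.2.2.1, x.2.2.2.2))]⟩)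

/-- The grammar of `P`. -/
noncomputable abbrev grammar : ContextFreeGrammar A where
  NT := P.GrammarNT
  initial := none
  rules := P.grammarRules

lemma mem_grammarRules (r : ContextFreeRule A P.GrammarNT) :
    r ∈ P.grammarRules ↔
      (∃ q₀ ∈ P.init, ∃ q ∈ P.final, r = ⟨none, [.nonterminal (some (q₀, some P.bottom, q))]⟩) ∨
      (∃ q, r = ⟨some (q, none, q), []⟩) ∨
      ∃ t ∈ P.transitions, ∃ o o' q' q, o.toList = t.pop.toList ++ o'.toList ∧
        r = ⟨some (t.src, o, q), t.read.toList.map .terminal ++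
          [.nonterminal (some (t.tgt, t.push, q')), .nonterminal (some (q', o', q))]⟩ := by
  simp only [grammarRules, Finset.mem_union, Finset.mem_image, Finset.mem_product,
    List.mem_toFinset, Finset.mem_univ, true_and, and_true, Finset.mem_filter, Prod.exists, or_assoc]
  constructor
  · rintro (⟨a, b, ⟨h1, h2⟩, rfl⟩ | ⟨q, rfl⟩ | ⟨t, o, o', q', q, ⟨h1, h2⟩, rfl⟩)
    · exact .inl ⟨a, h1, b, h2, rfl⟩
    · exact .inr (.inl ⟨q, rfl⟩)
    · exact .inr (.inr ⟨t, h1, o, o', q', q, h2, rfl⟩)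
  · rintro (⟨a, h1, b, h2, rfl⟩ | ⟨q, rfl⟩ | ⟨t, h1, o, o', q', q, h2, rfl⟩)
    · exact .inl ⟨a, b, ⟨h1, h2⟩, rfl⟩
    · exact .inr (.inl ⟨q, rfl⟩)
    · exact .inr (.inr ⟨t, o, o', q', q, ⟨h1, h2⟩, rfl⟩)

/-- The language for which a symbol of the grammar of `P` stands. -/
def symbolLanguage : Symbol A P.GrammarNT → Language A
  | .terminal a => {[a]}
  | .nonterminal none => P.language
  | .nonterminal (some (p, o, q)) => P.emptying p o q

lemma prod_symbolLanguage_terminal (w : List A) :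
    ((w.map Symbol.terminal).map P.symbolLanguage).prod = ({w} : Language A) := by
  induction w with
  | nil => rfl
  | cons a w ih =>
    simp only [List.map_cons, List.prod_cons, ih, symbolLanguage]
    ext x
    rw [Language.mem_mul]
    constructor
    · rintro ⟨_, rfl, _, rfl, rfl⟩
      rfl
    · rintro rfl
      exact ⟨_, rfl, _, rfl, rfl⟩

/-- The languages of the symbols satisfy the inequations given by the rules. -/
lemma prod_symbolLanguage_le {r : ContextFreeRule A P.GrammarNT} (hr : r ∈ P.grammarRules) :
    (r.output.map P.symbolLanguage).prod ≤ P.symbolLanguage (.nonterminal r.input) := by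
  rcases (P.mem_grammarRules r).1 hr with
    ⟨q₀, h0, q, hq, rfl⟩ | ⟨q, rfl⟩ | ⟨t, ht, o, o', q', q, ho, rfl⟩
  · simp only [List.map_cons, List.map_nil, List.prod_cons, List.prod_nil, mul_one]
    exact fun w hw => ⟨q₀, h0, q, hq, hw⟩
  · rintro w rfl
    exact Relation.ReflTransGen.refl
  · rw [List.map_append, List.prod_append, prod_symbolLanguage_terminal]
    simp only [List.map_cons, List.map_nil, List.prod_cons, List.prod_nil, mul_one, symbolLanguage]
    rintro _ ⟨_, rfl, _, ⟨w₁, hw₁, w₂, hw₂, rfl⟩, rfl⟩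
    refine Relation.ReflTransGen.head
      (b := ⟨t.tgt, w₁ ++ w₂, t.push.toList ++ o'.toList⟩) ?_ ?_
    · exact ⟨t, ht, rfl, rfl, rfl, o'.toList, ho, rfl⟩
    · exact (reflTransGen_append hw₁ w₂ o'.toList).trans hw₂

lemma prod_symbolLanguage_anti {α β : List (Symbol A P.GrammarNT)}
    (h : P.grammar.Derives α β) :
    (β.map P.symbolLanguage).prod ≤ (α.map P.symbolLanguage).prod := by
  induction h with
  | refl => exact le_rfl
  | tail _ h ih =>
    refine le_trans ?_ ih
    obtain ⟨r, hr, h⟩ := h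
    obtain ⟨x, y, rfl, rfl⟩ := h.exists_parts
    simp only [List.map_append, List.prod_append, List.map_cons, List.map_nil, List.prod_cons,
      List.prod_nil, mul_one]
    exact mul_le_mul' (mul_le_mul' le_rfl (P.prod_symbolLanguage_le hr)) le_rfl

lemma derives_of_run {k : ℕ} {p q : Fin P.numStates} {o : Option (Fin P.numSymbols)} {w : List A}
    (h : P.Run k ⟨p, w, o.toList⟩ ⟨q, [], []⟩) :
    P.grammar.Derives [.nonterminal (some (p, o, q))] (w.map .terminal) := by
  induction k using Nat.strong_induction_on generalizing p q o w with
  | _ k ih =>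
  cases k with
  | zero =>
    simp only [Run, ID.mk.injEq] at h
    obtain ⟨rfl, rfl, h⟩ := h
    obtain rfl : o = none := by simpa using h
    refine Relation.ReflTransGen.single ⟨_, (P.mem_grammarRules _).2 (.inr (.inl ⟨p, rfl⟩)), ?_⟩
    exact ContextFreeRule.Rewrites.input_output
  | succ k =>
    obtain ⟨⟨p', w', s'⟩, ⟨t, ht, h1, h2, h3, r, h4, h5⟩, hrun⟩ := h
    simp only at h1 h2 h3 h4 h5
    -- A stack with at most one symbol has at most one symbol left below what the move pops.
    obtain ⟨o', rfl⟩ : ∃ o' : Option (Fin P.numSymbols), r = o'.toList := by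
      rcases r with - | ⟨γ, - | ⟨δ, r⟩⟩
      · exact ⟨none, rfl⟩
      · exact ⟨some γ, rfl⟩
      · have := congrArg List.length h4
        cases o <;> simp at this
        omega
    subst h1 h2 h3 h5
    obtain ⟨q', w₁, w₂, k₁, k₂, rfl, hk, hrun₁, hrun₂⟩ := hrun.split
    have hr := (P.mem_grammarRules _).2 (.inr (.inr ⟨t, ht, o, o', q', q, h4, rfl⟩))
    refine Relation.ReflTransGen.head ⟨_, hr, ContextFreeRule.Rewrites.input_output⟩ ?_
    simp only [List.map_append]
    refine ContextFreeGrammar.Derives.append_left ?_ _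
    exact ((ih k₁ (by omega) hrun₁).append_right [_]).trans
      ((ih k₂ (by omega) hrun₂).append_left _)

/-- The language of a pushdown automaton is context-free. -/
theorem isContextFree_language : P.language.IsContextFree := by
  refine ⟨P.grammar, ?_⟩
  ext w
  rw [ContextFreeGrammar.mem_language_iff]
  constructor
  · intro h
    have := P.prod_symbolLanguage_anti h
    rw [prod_symbolLanguage_terminal] at this
    simp only [List.map_cons, List.map_nil, List.prod_cons, List.prod_nil, mul_one] at this
    exact this (Set.mem_singleton w)
  · rintro ⟨q₀, h0, q, hq, h⟩
    obtain ⟨k, hk⟩ := exists_run_of_reflTransGen h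
    refine Relation.ReflTransGen.head ⟨_, (P.mem_grammarRules _).2 (.inl ⟨q₀, h0, q, hq, rfl⟩),
      ContextFreeRule.Rewrites.input_output⟩ ?_
    exact P.derives_of_run (o := some P.bottom) hk

end PDA

/-! ### The automaton that undoes keystrokes -/

/-- A state written as a number that may depend on a counter: `offset`, plus the value of the
counter if `relative` is set. -/
structure StateRef where
  relative : Bool
  offset : ℕ

/-- The state meant by a reference when the counter is `c`. -/
def StateRef.eval (c : ℕ) (r : StateRef) : ℕ := (if r.relative then c else 0) + r.offset

/-- The state with the fixed number `k`. -/
abbrev StateRef.fixed (k : ℕ) : StateRef := ⟨false, k⟩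

/-- The state whose number is the counter plus `k`. -/
abbrev StateRef.shifted (k : ℕ) : StateRef := ⟨true, k⟩

/-- A transition of a pushdown automaton with `m` stack symbols, up to the value of the counter. -/
structure Template (A : Type) (m : ℕ) where
  src : StateRef
  read : Option A
  pop : Option (Fin m)
  push : Option (Fin m)
  tgt : StateRef

/-- The transition obtained from a template when the counter is `c`. State numbers are taken
modulo `N`, which never matters for the automata below. -/
def Template.toTransition {m : ℕ} (N : ℕ) [NeZero N] (c : ℕ) (t : Template A m) :
    PDATransition A N m :=
  ⟨Fin.ofNat N (t.src.eval c), t.read, t.pop, t.push, Fin.ofNat N (t.tgt.eval c)⟩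

/-- Whether a symbol is the separator between transient and final keys. -/
def KeyboardSym.isSep : KeyboardSym A → Bool
  | .sep => true
  | _ => false

section Automaton

variable [Fintype A]

/-- The stack symbol that stands for a letter; the symbol `0` is the bottom of the stack. -/
noncomputable def letterSym (a : A) : Fin (Fintype.card A + 1) := (Fintype.equivFin A a).succ

/-- What has to be read, popped and pushed in order to undo an operation. The letters to the left
of the cursor are on the stack, those to the right are still to be read. A backspace or left arrow
that had no effect is undone by checking that the stack is at its bottom. The right arrow, which is
outside the class of keyboards considered here, gets no moves. -/
noncomputable def undoMoves :
    Op A → List (Option A × Option (Fin (Fintype.card A + 1)) × Option (Fin (Fintype.card A + 1)))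
  | .write a => [(none, some (letterSym a), none)]
  | .backspace =>
    (none, some 0, some 0) :: Finset.univ.toList.map fun a => (none, none, some (letterSym a))
  | .left =>
    (none, some 0, some 0) :: Finset.univ.toList.map fun a => (some a, none, some (letterSym a))
  | .right => []

/-- The transitions contributed by a symbol of the written keyboard. The counter is the
position of the symbol plus one. State `0` guesses the letters to the left of the cursor, and moves
to the end of a final key; state `1` is reached whenever a key is completely undone, and moves to
the end of a transient key. The Boolean tells whether the separator has been passed, that is, whether
the current key is final. -/
noncomputable def symTemplates (b : Bool) :
    KeyboardSym A → List (Template A (Fintype.card A + 1))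
  | .op o => (undoMoves o).map fun x => ⟨.shifted 3, x.1, x.2.1, x.2.2, .shifted 2⟩
  | .endKey => [⟨.fixed (if b then 0 else 1), none, none, none, .shifted 2⟩,
      ⟨.shifted 3, none, none, none, .fixed 1⟩]
  | .sep => [⟨.shifted 3, none, none, none, .fixed 1⟩]

/-- The transitions that do not belong to a symbol of the written keyboard. State `2` is the
accepting state, and state `3` is the beginning of the first key. -/
noncomputable def baseTemplates : List (Template A (Fintype.card A + 1)) :=
  ⟨.fixed 1, none, some 0, none, .fixed 2⟩ :: ⟨.fixed 3, none, none, none, .fixed 1⟩ ::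
    Finset.univ.toList.map fun a =>
      ⟨.fixed 0, some a, none, some (letterSym a), .fixed 0⟩

/-- The transitions contributed by the symbols of a word, if the counter starts at `c`. The
transitions of later symbols come first, since a Turing machine that reads the word writes its
output from right to left. -/
noncomputable def symTransitions (N : ℕ) [NeZero N] :
    Bool → ℕ → List (KeyboardSym A) → List (PDATransition A N (Fintype.card A + 1))
  | _, _, [] => []
  | b, c, x :: s => symTransitions N (b || x.isSep) (c + 1) s ++
      (symTemplates b x).map (Template.toTransition N c)

/-- The transitions of the automaton `undoPDA x`. -/
noncomputable def undoTransitions (x : KeyboardListing A) :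
    List (PDATransition A ((encodeKeyboard x).length + 4) (Fintype.card A + 1)) :=
  symTransitions _ false 1 (encodeKeyboard x) ++ baseTemplates.map (Template.toTransition _ 0)

/-- The automaton that undoes the keystrokes of a keyboard. State `i + 3` is the position `i` in
the written keyboard. -/
noncomputable def undoPDA (x : KeyboardListing A) : PDA A where
  numStates := (encodeKeyboard x).length + 4
  numSymbols := Fintype.card A + 1
  bottom := 0
  init := [0]
  final := [2]
  transitions := undoTransitions x

lemma mem_symTransitions {N : ℕ} [NeZero N] {b : Bool} {c : ℕ} {s : List (KeyboardSym A)}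
    {t : PDATransition A N (Fintype.card A + 1)} :
    t ∈ symTransitions N b c s ↔ ∃ pre x post, s = pre ++ x :: post ∧
      ∃ t' ∈ symTemplates (b || pre.any KeyboardSym.isSep) x,
        t = t'.toTransition N (c + pre.length) := by
  induction s generalizing b c with
  | nil => simp [symTransitions]
  | cons y s ih =>
    simp only [symTransitions, List.mem_append, ih, List.mem_map]
    constructor
    · rintro (⟨pre, x, post, rfl, t', ht', rfl⟩ | ⟨t', ht', rfl⟩)
      · refine ⟨y :: pre, x, post, rfl, t', by simpa [Bool.or_assoc] using ht', ?_⟩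
        simp [Nat.add_assoc, Nat.add_comm 1]
      · exact ⟨[], y, s, rfl, t', by simpa using ht', rfl⟩
    · rintro ⟨pre, x, post, h, t', ht', rfl⟩
      cases pre with
      | nil =>
        obtain ⟨rfl, rfl⟩ := List.cons.inj h
        exact .inr ⟨t', by simpa using ht', rfl⟩
      | cons z pre =>
        obtain ⟨rfl, rfl⟩ := List.cons.inj h
        refine .inl ⟨pre, x, post, rfl, t', by simpa [Bool.or_assoc] using ht', ?_⟩
        simp [Nat.add_assoc, Nat.add_comm 1]

/-! ### Undoing one operation -/

/-- The stack that represents the text to the left of the cursor, with the last letter on top. -/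
noncomputable def stackOf (u : List A) : List (Fin (Fintype.card A + 1)) :=
  (u.map letterSym).reverse ++ [0]

@[simp] lemma stackOf_nil : stackOf ([] : List A) = [0] := rfl

@[simp] lemma stackOf_concat (u : List A) (a : A) :
    stackOf (u ++ [a]) = letterSym a :: stackOf u := by
  simp [stackOf]

lemma letterSym_injective : Function.Injective (letterSym (A := A)) := fun a b h => by
  simpa [letterSym] using h

lemma letterSym_ne_zero (a : A) : letterSym a ≠ 0 := Fin.succ_ne_zero _

lemma stackOf_eq_zero_cons {u : List A} {r : List (Fin (Fintype.card A + 1))}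
    (h : stackOf u = 0 :: r) : u = [] ∧ r = [] := by
  rcases List.eq_nil_or_concat' u with rfl | ⟨u, a, rfl⟩
  · simpa [eq_comm] using h
  · rw [stackOf_concat] at h
    exact absurd (List.cons.inj h).1 (letterSym_ne_zero a)

lemma stackOf_eq_letterSym_cons {u : List A} {a : A} {r : List (Fin (Fintype.card A + 1))}
    (h : stackOf u = letterSym a :: r) : ∃ u', u = u' ++ [a] ∧ r = stackOf u' := by
  rcases List.eq_nil_or_concat' u with rfl | ⟨u, b, rfl⟩
  · exact absurd (List.cons.inj h).1.symm (letterSym_ne_zero a)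
  · rw [stackOf_concat] at h
    obtain ⟨h1, rfl⟩ := List.cons.inj h
    exact ⟨u, by rw [letterSym_injective h1], rfl⟩

/-- Every undoing move is sound: it leads to a configuration from which the operation leads back. -/
lemma act_of_mem_undoMoves {o : Op A}
    {m : Option A × Option (Fin (Fintype.card A + 1)) × Option (Fin (Fintype.card A + 1))}
    (hm : m ∈ undoMoves o) {u v : List A} {r : List (Fin (Fintype.card A + 1))}
    (h : stackOf u = m.2.2.toList ++ r) :
    ∃ u', m.2.1.toList ++ r = stackOf u' ∧ Config.act (u, v) o = (u', m.1.toList ++ v) := by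
  cases o with
  | write a =>
    obtain rfl : m = _ := by simpa [undoMoves] using hm
    obtain rfl : stackOf u = r := by simpa using h
    exact ⟨u ++ [a], by simp, rfl⟩
  | backspace =>
    simp only [undoMoves, List.mem_cons, List.mem_map, Finset.mem_toList, Finset.mem_univ,
      true_and] at hm
    rcases hm with rfl | ⟨a, rfl⟩
    · obtain ⟨rfl, rfl⟩ := stackOf_eq_zero_cons h
      exact ⟨[], rfl, rfl⟩
    · obtain ⟨u', rfl, rfl⟩ := stackOf_eq_letterSym_cons h
      exact ⟨u', rfl, by simp [Config.act]⟩
  | left =>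
    simp only [undoMoves, List.mem_cons, List.mem_map, Finset.mem_toList, Finset.mem_univ,
      true_and] at hm
    rcases hm with rfl | ⟨a, rfl⟩
    · obtain ⟨rfl, rfl⟩ := stackOf_eq_zero_cons h
      exact ⟨[], rfl, rfl⟩
    · obtain ⟨u', rfl, rfl⟩ := stackOf_eq_letterSym_cons h
      exact ⟨u', rfl, by simp [Config.act]⟩
  | right => simp [undoMoves] at hm

/-- Every operation other than the right arrow can be undone. -/
lemma exists_mem_undoMoves {o : Op A} (ho : o ≠ .right) (c : Config A) :
    ∃ m ∈ undoMoves o, ∃ r, stackOf c.1 = m.2.2.toList ++ r ∧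
      stackOf (c.act o).1 = m.2.1.toList ++ r ∧ (c.act o).2 = m.1.toList ++ c.2 := by
  obtain ⟨u, v⟩ := c
  cases o with
  | write a =>
    exact ⟨_, List.mem_singleton_self _, stackOf u, rfl, by simp [Config.act], rfl⟩
  | backspace =>
    rcases List.eq_nil_or_concat' u with rfl | ⟨u, a, rfl⟩
    · exact ⟨_, List.mem_cons_self, [], rfl, rfl, rfl⟩
    · exact ⟨_, List.mem_cons_of_mem _ (List.mem_map_of_mem (Finset.mem_toList.2
        (Finset.mem_univ a))), stackOf u, by simp, by simp [Config.act], rfl⟩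
  | left =>
    rcases List.eq_nil_or_concat' u with rfl | ⟨u, a, rfl⟩
    · exact ⟨_, List.mem_cons_self, [], rfl, rfl, rfl⟩
    · exact ⟨_, List.mem_cons_of_mem _ (List.mem_map_of_mem (Finset.mem_toList.2
        (Finset.mem_univ a))), stackOf u, by simp, by simp [Config.act], by simp [Config.act]⟩
  | right => exact absurd rfl ho

end Automaton

/-! ### Keys in the written keyboard -/

/-- The operations at the end of a word, back to the last end mark or separator. -/
def openKey (s : List (KeyboardSym A)) : Key A :=
  s.foldl (fun p x => match x with
    | .op o => p ++ [o]
    | _ => []) []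

@[simp] lemma openKey_concat_op (s : List (KeyboardSym A)) (o : Op A) :
    openKey (s ++ [.op o]) = openKey s ++ [o] := by
  simp [openKey]

@[simp] lemma openKey_concat_endKey (s : List (KeyboardSym A)) : openKey (s ++ [.endKey]) = [] := by
  simp [openKey]

@[simp] lemma openKey_concat_sep (s : List (KeyboardSym A)) : openKey (s ++ [.sep]) = [] := by
  simp [openKey]

lemma openKey_append_map_op (s : List (KeyboardSym A)) (t : Key A) :
    openKey (s ++ t.map .op) = openKey s ++ t := by
  induction t using List.reverseRecOn with
  | nil => simp
  | append_singleton t o ih =>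
    rw [List.map_append, List.map_singleton, ← List.append_assoc, openKey_concat_op, ih,
      List.append_assoc]

lemma openKey_mem_of_flatMap_eq {ks : List (Key A)} {s pre post : List (KeyboardSym A)}
    (hs : openKey s = []) (h : ks.flatMap encodeKey = pre ++ .endKey :: post) :
    openKey (s ++ pre) ∈ ks := by
  induction ks generalizing s pre with
  | nil => simp at h
  | cons t ks ih =>
    rw [List.flatMap_cons, encodeKey, List.append_assoc, List.singleton_append,
      List.append_eq_append_iff] at h
    rcases h with ⟨a, rfl, h⟩ | ⟨a, h, h'⟩
    · cases a with
      | nil => simp [openKey_append_map_op, hs]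
      | cons y a =>
        obtain ⟨rfl, h'⟩ := List.cons.inj h
        have := ih (s := s ++ t.map .op ++ [.endKey]) (openKey_concat_endKey _) h'
        exact List.mem_cons_of_mem _ (by simpa using this)
    · cases a with
      | nil =>
        obtain rfl : pre = t.map .op := by simpa using h.symm
        simp [openKey_append_map_op, hs]
      | cons y a =>
        obtain ⟨rfl, -⟩ := List.cons.inj h'
        have : KeyboardSym.endKey ∈ t.map KeyboardSym.op := by rw [h]; simp
        simp at this

lemma any_isSep_flatMap_encodeKey (ks : List (Key A)) :
    (ks.flatMap encodeKey).any KeyboardSym.isSep = false := by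
  simp only [List.any_eq_false, List.mem_flatMap, encodeKey, List.mem_append, List.mem_map,
    List.mem_singleton]
  rintro x ⟨t, -, ⟨o, -, rfl⟩ | rfl⟩ <;> simp [KeyboardSym.isSep]

/-- The key before an end mark is a listed key, and it is final if the separator has been passed. -/
lemma openKey_mem_of_encodeKeyboard_eq {x : KeyboardListing A} {pre post : List (KeyboardSym A)}
    (h : encodeKeyboard x = pre ++ .endKey :: post) :
    openKey pre ∈ if pre.any KeyboardSym.isSep then x.2 else x.1 := by
  rw [encodeKeyboard, List.append_assoc, List.singleton_append, List.append_eq_append_iff] at h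
  rcases h with ⟨a, rfl, h⟩ | ⟨a, h, h'⟩
  · cases a with
    | nil => simp at h
    | cons y a =>
      obtain ⟨rfl, h'⟩ := List.cons.inj h
      have := openKey_mem_of_flatMap_eq (s := x.1.flatMap encodeKey ++ [.sep]) (by simp) h'
      simpa [KeyboardSym.isSep] using this
  · cases a with
    | nil => simp at h'
    | cons y a =>
      obtain ⟨rfl, -⟩ := List.cons.inj h'
      have hsep := any_isSep_flatMap_encodeKey x.1
      rw [h, List.any_append, Bool.or_eq_false_iff] at hsep
      rw [hsep.1]
      simpa using openKey_mem_of_flatMap_eq (s := []) rfl h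

/-- The positions at which a key may begin: those after nothing, an end mark or a separator. -/
def IsKeyStart (pre : List (KeyboardSym A)) : Prop :=
  pre = [] ∨ (∃ p, pre = p ++ [.endKey]) ∨ ∃ p, pre = p ++ [.sep]

lemma isKeyStart_append_flatMap {pre : List (KeyboardSym A)} (hp : IsKeyStart pre)
    (ks : List (Key A)) : IsKeyStart (pre ++ ks.flatMap encodeKey) := by
  rcases List.eq_nil_or_concat' ks with rfl | ⟨ks, t, rfl⟩
  · simpa using hp
  · exact .inr (.inl ⟨pre ++ ks.flatMap encodeKey ++ t.map .op, by simp [encodeKey]⟩)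

lemma exists_encodeKeyboard_eq_of_mem_fst {x : KeyboardListing A} {t : Key A} (ht : t ∈ x.1) :
    ∃ pre post, encodeKeyboard x = pre ++ t.map .op ++ .endKey :: post ∧ IsKeyStart pre ∧
      (pre ++ t.map KeyboardSym.op).any KeyboardSym.isSep = false := by
  obtain ⟨k₁, k₂, hk⟩ := List.append_of_mem ht
  refine ⟨k₁.flatMap encodeKey, k₂.flatMap encodeKey ++ .sep :: x.2.flatMap encodeKey,
    by simp [encodeKeyboard, hk, encodeKey], ?_, ?_⟩
  · simpa using isKeyStart_append_flatMap (.inl rfl) k₁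
  · rw [List.any_append, any_isSep_flatMap_encodeKey]
    simp [KeyboardSym.isSep]

lemma exists_encodeKeyboard_eq_of_mem_snd {x : KeyboardListing A} {t : Key A} (ht : t ∈ x.2) :
    ∃ pre post, encodeKeyboard x = pre ++ t.map .op ++ .endKey :: post ∧ IsKeyStart pre ∧
      (pre ++ t.map KeyboardSym.op).any KeyboardSym.isSep = true := by
  obtain ⟨k₁, k₂, hk⟩ := List.append_of_mem ht
  refine ⟨x.1.flatMap encodeKey ++ [.sep] ++ k₁.flatMap encodeKey, k₂.flatMap encodeKey,
    by simp [encodeKeyboard, hk, encodeKey], ?_, ?_⟩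
  · exact isKeyStart_append_flatMap (.inr (.inr ⟨_, rfl⟩)) k₁
  · simp [KeyboardSym.isSep]

/-! ### Correctness of the automaton -/

lemma Config.actKey_concat (c : Config A) (t : Key A) (o : Op A) :
    c.actKey (t ++ [o]) = (c.actKey t).act o := by
  simp [Config.actKey]

lemma Config.actKeys_concat (c : Config A) (τ : List (Key A)) (t : Key A) :
    c.actKeys (τ ++ [t]) = (c.actKeys τ).actKey t := by
  simp [Config.actKeys]

/-- The configurations reached from the empty one by transient keys. -/
def transientReach (x : KeyboardListing A) : Set (Config A) :=
  {c | ∃ τ : List (Key A), (∀ t ∈ τ, t ∈ x.1) ∧ Config.actKeys ([], []) τ = c}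

lemma nil_mem_transientReach (x : KeyboardListing A) : (([], []) : Config A) ∈ transientReach x :=
  ⟨[], by simp, rfl⟩

lemma actKey_mem_transientReach {x : KeyboardListing A} {c : Config A} (hc : c ∈ transientReach x)
    {t : Key A} (ht : t ∈ x.1) : c.actKey t ∈ transientReach x := by
  obtain ⟨τ, hτ, rfl⟩ := hc
  refine ⟨τ ++ [t], ?_, Config.actKeys_concat _ _ _⟩
  simp only [List.mem_append, List.mem_singleton]
  rintro s (hs | rfl)
  exacts [hτ s hs, ht]

/-- The words `u v` such that `(u, v)` is reached by the listed keys. -/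
def KeyboardListing.language (x : KeyboardListing A) : Language A :=
  {w | ∃ c ∈ transientReach x, ∃ f ∈ x.2, (c.actKey f).1 ++ (c.actKey f).2 = w}

lemma language_eq_of_lists {x : KeyboardListing A} {K : Keyboard A} (hx : x.Lists K) :
    x.language = K.language := by
  ext w
  constructor
  · rintro ⟨c, ⟨τ, hτ, rfl⟩, f, hf, rfl⟩
    exact ⟨τ, fun t ht => (hx.1 t).1 (hτ t ht), f, (hx.2 f).1 hf, _, _,
      Config.actKeys_concat _ _ _, rfl⟩
  · rintro ⟨τ, hτ, f, hf, u, v, h, rfl⟩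
    refine ⟨_, ⟨τ, fun t ht => (hx.1 t).2 (hτ t ht), rfl⟩, f, (hx.2 f).2 hf, ?_⟩
    rw [← Config.actKeys_concat, h]

section Correctness

variable [Fintype A] (x : KeyboardListing A)

/-- What it means for the keyboard that the automaton accepts from a state, given the remaining
input `w` and the stack `s`. Position `i` means that `(u, w)` is reached by transient keys followed
by the part of the current key before `i`; state `0` means that a final key leads to a configuration
whose left part begins with `u` and whose text ends with `w`. -/
def StateMeaning (w : List A) (s : List (Fin (Fintype.card A + 1))) : ℕ → Prop
  | 0 => ∃ u u' v, s = stackOf u ∧ w = u' ++ v ∧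
      ∃ c ∈ transientReach x, ∃ f ∈ x.2, c.actKey f = (u ++ u', v)
  | 1 => ∃ u, s = stackOf u ∧ (u, w) ∈ transientReach x
  | 2 => s = [] ∧ w = []
  | i + 3 => ∃ u, s = stackOf u ∧ ∃ c ∈ transientReach x,
      c.actKey (openKey ((encodeKeyboard x).take i)) = (u, w)

variable {x}

lemma mem_undoTransitions
    {t : PDATransition A ((encodeKeyboard x).length + 4) (Fintype.card A + 1)} :
    t ∈ undoTransitions x ↔
      (∃ pre y post, encodeKeyboard x = pre ++ y :: post ∧
        ∃ t' ∈ symTemplates (pre.any KeyboardSym.isSep) y,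
          t = t'.toTransition _ (pre.length + 1)) ∨
      ∃ t' ∈ baseTemplates, t = t'.toTransition _ 0 := by
  simp only [undoTransitions, List.mem_append, mem_symTransitions, Bool.false_or, Nat.add_comm 1,
    List.mem_map, eq_comm (b := t)]

lemma StateRef.eval_fixed (c k : ℕ) : (StateRef.fixed k).eval c = k := by simp [StateRef.eval]

lemma StateRef.eval_shifted (c k : ℕ) : (StateRef.shifted k).eval c = c + k := by
  simp [StateRef.eval]

/-- Applying a template backwards preserves the meaning of the states. -/
lemma StateMeaning.of_symTemplate {pre post : List (KeyboardSym A)} {y : KeyboardSym A}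
    (hx : encodeKeyboard x = pre ++ y :: post) {t : Template A (Fintype.card A + 1)}
    (ht : t ∈ symTemplates (pre.any KeyboardSym.isSep) y) {w : List A}
    {r : List (Fin (Fintype.card A + 1))}
    (h : StateMeaning x w (t.push.toList ++ r) (t.tgt.eval (pre.length + 1))) :
    StateMeaning x (t.read.toList ++ w) (t.pop.toList ++ r) (t.src.eval (pre.length + 1)) := by
  have htake : (encodeKeyboard x).take pre.length = pre := by simp [hx]
  have htake' : (encodeKeyboard x).take (pre.length + 1) = pre ++ [y] := by
    rw [hx, ← List.singleton_append, ← List.append_assoc]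
    exact List.take_left' (by simp)
  have hadd : pre.length + 1 + 2 = pre.length + 3 := rfl
  cases y with
  | op o =>
    obtain ⟨m, hm, rfl⟩ := List.mem_map.1 ht
    simp only [StateRef.eval_shifted, hadd] at h ⊢
    obtain ⟨u, hu, c, hc, hcu⟩ := h
    obtain ⟨u', hu', hact⟩ := act_of_mem_undoMoves hm hu.symm
    refine ⟨u', hu', c, hc, ?_⟩
    rw [htake', openKey_concat_op, Config.actKey_concat, ← htake, hcu, hact]
  | endKey =>
    simp only [symTemplates, List.mem_cons, List.not_mem_nil, or_false] at ht
    -- The first template enters the key that ends here, the second is used after a key that begins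
    -- behind this end mark has been undone.
    have hmem := openKey_mem_of_encodeKeyboard_eq hx
    rcases ht with rfl | rfl
    · simp only [StateRef.eval_shifted, StateRef.eval_fixed, hadd] at h ⊢
      obtain ⟨u, hu, c, hc, hcu⟩ := h
      rw [htake] at hcu
      split_ifs at hmem ⊢
      · exact ⟨u, [], w, hu, rfl, c, hc, _, hmem, by simpa using hcu⟩
      · exact ⟨u, hu, by simpa [← hcu] using actKey_mem_transientReach hc hmem⟩
    · simp only [StateRef.eval_shifted, StateRef.eval_fixed] at h ⊢
      obtain ⟨u, hu, hmem⟩ := h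
      exact ⟨u, hu, _, hmem, by rw [htake', openKey_concat_endKey]; rfl⟩
  | sep =>
    obtain rfl := List.mem_singleton.1 ht
    simp only [StateRef.eval_shifted, StateRef.eval_fixed] at h ⊢
    obtain ⟨u, hu, hmem⟩ := h
    exact ⟨u, hu, _, hmem, by rw [htake', openKey_concat_sep]; rfl⟩

lemma StateMeaning.of_baseTemplate {t : Template A (Fintype.card A + 1)}
    (ht : t ∈ baseTemplates) {w : List A} {r : List (Fin (Fintype.card A + 1))}
    (h : StateMeaning x w (t.push.toList ++ r) (t.tgt.eval 0)) :
    StateMeaning x (t.read.toList ++ w) (t.pop.toList ++ r) (t.src.eval 0) := by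
  simp only [baseTemplates, List.mem_cons, List.mem_map, Finset.mem_toList, Finset.mem_univ,
    true_and] at ht
  rcases ht with rfl | rfl | ⟨a, rfl⟩
  · obtain ⟨rfl, rfl⟩ := h
    exact ⟨[], rfl, nil_mem_transientReach x⟩
  · obtain ⟨u, hu, hmem⟩ := h
    exact ⟨u, hu, _, hmem, rfl⟩
  · obtain ⟨u, u', v, hu, hw, c, hc, f, hf, hcf⟩ := h
    obtain ⟨u₀, rfl, rfl⟩ := stackOf_eq_letterSym_cons hu.symm
    exact ⟨u₀, a :: u', v, rfl, by simpa [StateRef.eval] using hw, c, hc, f, hf, by simpa using hcf⟩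

lemma Template.eval_lt_of_mem_symTemplates {b : Bool} {y : KeyboardSym A}
    {t : Template A (Fintype.card A + 1)} (ht : t ∈ symTemplates b y) (c : ℕ) :
    t.src.eval c < c + 4 ∧ t.tgt.eval c < c + 4 := by
  cases y with
  | op o =>
    obtain ⟨m, -, rfl⟩ := List.mem_map.1 ht
    simp [StateRef.eval]
  | endKey =>
    simp only [symTemplates, List.mem_cons, List.not_mem_nil, or_false] at ht
    rcases ht with rfl | rfl
    · cases b <;> simp [StateRef.eval]
    · simp [StateRef.eval]
  | sep =>
    obtain rfl := List.mem_singleton.1 ht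
    simp [StateRef.eval]

lemma Template.eval_lt_of_mem_baseTemplates
    {t : Template A (Fintype.card A + 1)} (ht : t ∈ baseTemplates) (c : ℕ) :
    t.src.eval c < 4 ∧ t.tgt.eval c < 4 := by
  simp only [baseTemplates, List.mem_cons, List.mem_map, Finset.mem_toList, Finset.mem_univ,
    true_and] at ht
  rcases ht with rfl | rfl | ⟨a, rfl⟩ <;> simp [StateRef.eval]

lemma StateMeaning.of_step {c d : (undoPDA x).ID} (h : (undoPDA x).Step c d)
    (hd : StateMeaning x d.input d.stack d.state.val) :
    StateMeaning x c.input c.stack c.state.val := by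
  obtain ⟨t, ht, h1, h2, h3, r, h4, h5⟩ := h
  rw [h2, h5] at hd
  rw [h1, h3, h4]
  rcases mem_undoTransitions.1 ht with ⟨pre, y, post, hx, t', ht', rfl⟩ | ⟨t', ht', rfl⟩
  · have hlt := Template.eval_lt_of_mem_symTemplates ht' (pre.length + 1)
    have hlen : pre.length + 1 ≤ (encodeKeyboard x).length := by simp [hx]
    have := StateMeaning.of_symTemplate (w := d.input) (r := r) hx ht'
    simp only [Template.toTransition, Fin.val_ofNat] at hd ⊢
    rw [Nat.mod_eq_of_lt (by omega)] at hd ⊢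
    exact this hd
  · have hlt := Template.eval_lt_of_mem_baseTemplates ht' 0
    have := StateMeaning.of_baseTemplate (x := x) (w := d.input) (r := r) ht'
    simp only [Template.toTransition, Fin.val_ofNat] at hd ⊢
    rw [Nat.mod_eq_of_lt (by omega)] at hd ⊢
    exact this hd

lemma language_undoPDA_le : (undoPDA x).language ≤ x.language := by
  rintro w ⟨q₀, h0, q, hq, h⟩
  obtain rfl : q₀ = (0 : Fin (_ + 4)) := List.mem_singleton.1 h0
  obtain rfl : q = (2 : Fin (_ + 4)) := List.mem_singleton.1 hq
  have key : ∀ c : (undoPDA x).ID,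
      Relation.ReflTransGen (undoPDA x).Step c ⟨(2 : Fin (_ + 4)), [], []⟩ →
      StateMeaning x c.input c.stack c.state.val := by
    intro c hc
    induction hc using Relation.ReflTransGen.head_induction_on with
    | refl => exact ⟨rfl, rfl⟩
    | head h _ ih => exact StateMeaning.of_step h ih
  obtain ⟨u, u', v, hu, rfl, c, hc, f, hf, hcf⟩ := key _ h
  obtain ⟨rfl, -⟩ := stackOf_eq_zero_cons hu.symm
  exact ⟨c, hc, f, hf, by simp [hcf]⟩

/-- The description in which the automaton is in state `k` and its stack and remaining input
represent the configuration `c`. -/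
noncomputable def undoID (x : KeyboardListing A) (k : ℕ) (c : Config A) : (undoPDA x).ID :=
  ⟨Fin.ofNat ((encodeKeyboard x).length + 4) k, c.2, stackOf c.1⟩

lemma step_undoID_of_symTemplate {pre post : List (KeyboardSym A)} {y : KeyboardSym A}
    (hx : encodeKeyboard x = pre ++ y :: post) {t : Template A (Fintype.card A + 1)}
    (ht : t ∈ symTemplates (pre.any KeyboardSym.isSep) y) {c d : Config A}
    {r : List (Fin (Fintype.card A + 1))} (h1 : c.2 = t.read.toList ++ d.2)
    (h2 : stackOf c.1 = t.pop.toList ++ r) (h3 : stackOf d.1 = t.push.toList ++ r) :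
    (undoPDA x).Step (undoID x (t.src.eval (pre.length + 1)) c)
      (undoID x (t.tgt.eval (pre.length + 1)) d) :=
  ⟨_, mem_undoTransitions.2 (.inl ⟨pre, y, post, hx, t, ht, rfl⟩), rfl, rfl, h1, r, h2, h3⟩

lemma step_undoID_of_baseTemplate {t : Template A (Fintype.card A + 1)}
    (ht : t ∈ baseTemplates) {c d : Config A}
    {r : List (Fin (Fintype.card A + 1))} (h1 : c.2 = t.read.toList ++ d.2)
    (h2 : stackOf c.1 = t.pop.toList ++ r) (h3 : stackOf d.1 = t.push.toList ++ r) :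
    (undoPDA x).Step (undoID x (t.src.eval 0) c) (undoID x (t.tgt.eval 0) d) :=
  ⟨_, mem_undoTransitions.2 (.inr ⟨t, ht, rfl⟩), rfl, rfl, h1, r, h2, h3⟩

/-- At the beginning of a key, the automaton may pass to state `1`. -/
lemma step_undoID_of_isKeyStart {pre post : List (KeyboardSym A)}
    (hx : encodeKeyboard x = pre ++ post) (hp : IsKeyStart pre) (c : Config A) :
    (undoPDA x).Step (undoID x (pre.length + 3) c) (undoID x 1 c) := by
  rcases hp with rfl | ⟨p, rfl⟩ | ⟨p, rfl⟩
  · exact step_undoID_of_baseTemplate (t := ⟨.fixed 3, none, none, none, .fixed 1⟩)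
      (by simp [baseTemplates]) rfl rfl rfl
  · have := step_undoID_of_symTemplate (x := x) (pre := p) (y := .endKey) (post := post)
      (by simpa using hx) (t := ⟨.shifted 3, none, none, none, .fixed 1⟩)
      (by simp [symTemplates]) (c := c) rfl rfl rfl
    rw [StateRef.eval_shifted, StateRef.eval_fixed] at this
    rw [List.length_append]
    exact this
  · have := step_undoID_of_symTemplate (x := x) (pre := p) (y := .sep) (post := post)
      (by simpa using hx) (t := ⟨.shifted 3, none, none, none, .fixed 1⟩)
      (by simp [symTemplates]) (c := c) rfl rfl rfl
    rw [StateRef.eval_shifted, StateRef.eval_fixed] at this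
    rw [List.length_append]
    exact this

/-- From the end of a key back to its beginning, the automaton undoes the key. -/
lemma reflTransGen_undoID_actKey {pre post : List (KeyboardSym A)} {t : Key A}
    (hx : encodeKeyboard x = pre ++ t.map .op ++ post) (ht : Op.right ∉ t) (c : Config A) :
    Relation.ReflTransGen (undoPDA x).Step
      (undoID x ((pre ++ t.map KeyboardSym.op).length + 3) (c.actKey t))
      (undoID x (pre.length + 3) c) := by
  induction t using List.reverseRecOn generalizing post with
  | nil =>
    rw [List.map_nil, List.append_nil]
    exact .refl
  | append_singleton t o ih =>
    simp only [List.mem_append, List.mem_singleton, not_or] at ht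
    rw [List.map_append, List.map_singleton] at hx ⊢
    have hx' : encodeKeyboard x = pre ++ t.map .op ++ .op o :: post := by simpa using hx
    obtain ⟨m, hm, r, h1, h2, h3⟩ := exists_mem_undoMoves (Ne.symm ht.2) (c.actKey t)
    refine Relation.ReflTransGen.head ?_ (ih hx' ht.1)
    have := step_undoID_of_symTemplate hx' (t := ⟨.shifted 3, m.1, m.2.1, m.2.2, .shifted 2⟩)
      (List.mem_map.2 ⟨m, hm, rfl⟩) h3 h2 h1
    rw [StateRef.eval_shifted, StateRef.eval_shifted] at this
    rw [Config.actKey_concat, ← List.append_assoc, List.length_append (bs := [_])]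
    exact this

/-- After entering a key at its end, the automaton undoes it and gets to state `1`. -/
lemma reflTransGen_undoID_endKey {pre post : List (KeyboardSym A)} {t : Key A}
    (hx : encodeKeyboard x = pre ++ t.map .op ++ .endKey :: post) (hp : IsKeyStart pre)
    (ht : Op.right ∉ t) (c : Config A) :
    Relation.ReflTransGen (undoPDA x).Step
      (undoID x (if (pre ++ t.map KeyboardSym.op).any KeyboardSym.isSep then 0 else 1)
        (c.actKey t)) (undoID x 1 c) := by
  have hstep := step_undoID_of_symTemplate hx
    (t := ⟨.fixed (if (pre ++ t.map KeyboardSym.op).any KeyboardSym.isSep then 0 else 1),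
      none, none, none, .shifted 2⟩) (List.mem_cons_self) (c := c.actKey t) rfl rfl rfl
  rw [StateRef.eval_shifted, StateRef.eval_fixed] at hstep
  exact .head hstep ((reflTransGen_undoID_actKey hx ht c).tail
    (step_undoID_of_isKeyStart (by rw [hx, List.append_assoc]) hp c))

/-- In state `0` the automaton moves letters from the input to the stack. -/
lemma reflTransGen_undoID_flush (u u' v : List A) :
    Relation.ReflTransGen (undoPDA x).Step (undoID x 0 (u, u' ++ v)) (undoID x 0 (u ++ u', v)) := by
  induction u' generalizing u with
  | nil =>
    rw [List.append_nil]
    exact .refl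
  | cons a u' ih =>
    have := step_undoID_of_baseTemplate (x := x)
      (t := ⟨.fixed 0, some a, none, some (letterSym a), .fixed 0⟩)
      (by simp [baseTemplates]) (c := (u, a :: (u' ++ v))) (d := (u ++ [a], u' ++ v))
      (r := stackOf u) rfl rfl (by simp)
    refine .head this ?_
    rw [StateRef.eval_fixed]
    simpa using ih (u ++ [a])

lemma le_language_undoPDA (h₁ : ∀ t ∈ x.1, Op.right ∉ t) (h₂ : ∀ t ∈ x.2, Op.right ∉ t) :
    x.language ≤ (undoPDA x).language := by
  rintro w ⟨c, ⟨τ, hτ, rfl⟩, f, hf, rfl⟩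
  refine ⟨(0 : Fin (_ + 4)), List.mem_singleton_self _, (2 : Fin (_ + 4)),
    List.mem_singleton_self _, ?_⟩
  have htrans : Relation.ReflTransGen (undoPDA x).Step
      (undoID x 1 (Config.actKeys ([], []) τ)) (undoID x 1 ([], [])) := by
    induction τ using List.reverseRecOn with
    | nil => exact .refl
    | append_singleton τ t ih =>
      simp only [List.mem_append, List.mem_singleton] at hτ
      have ht := hτ t (.inr rfl)
      obtain ⟨pre, post, hx, hp, hsep⟩ := exists_encodeKeyboard_eq_of_mem_fst ht
      have := reflTransGen_undoID_endKey hx hp (h₁ t ht) (Config.actKeys ([], []) τ)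
      rw [hsep, if_neg Bool.false_ne_true, ← Config.actKeys_concat] at this
      exact this.trans (ih fun s hs => hτ s (.inl hs))
  have hlast : (undoPDA x).Step (undoID x 1 ([], [])) ⟨(2 : Fin (_ + 4)), [], []⟩ :=
    ⟨_, mem_undoTransitions.2 (.inr ⟨⟨.fixed 1, none, some 0, none, .fixed 2⟩,
      List.mem_cons_self, rfl⟩), rfl, rfl, rfl, [], rfl, rfl⟩
  obtain ⟨pre, post, hx, hp, hsep⟩ := exists_encodeKeyboard_eq_of_mem_snd hf
  have hfin := reflTransGen_undoID_endKey hx hp (h₂ f hf) (Config.actKeys ([], []) τ)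
  rw [hsep, if_pos rfl] at hfin
  exact ((reflTransGen_undoID_flush [] _ _).trans (hfin.trans htrans)).tail hlast

theorem language_undoPDA {K : Keyboard A} (hK : K.IsBLEK) (hx : x.Lists K) :
    (undoPDA x).language = K.language := by
  rw [← language_eq_of_lists hx]
  exact le_antisymm language_undoPDA_le (le_language_undoPDA
    (fun t ht => hK.1 t ((hx.1 t).1 ht)) (fun t ht => hK.2 t ((hx.2 t).1 ht)))

theorem Keyboard.IsBLEK.isContextFree_language {K : Keyboard A} (hK : K.IsBLEK) :
    K.language.IsContextFree := by
  rw [← language_undoPDA (x := (K.transient.toList, K.final.toList)) hK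
    ⟨fun t => Finset.mem_toList, fun t => Finset.mem_toList⟩]
  exact PDA.isContextFree_language _

end Correctness

/-! ### Words with a counter -/

/-- The letters of programs that write words: a fixed symbol, or as many ones as the value of the
counter. -/
inductive Token (A : Type) where
  | sym (c : PDASym A)
  | counter

/-- The word written by a token when the counter is `c`. -/
def Token.expand (c : ℕ) : Token A → List (PDASym A)
  | .sym a => [a]
  | .counter => List.replicate c .one

lemma flatMap_expand_map_sym (c : ℕ) (w : List (PDASym A)) :
    (w.map Token.sym).flatMap (Token.expand c) = w := by
  induction w with
  | nil => rfl
  | cons a w ih => simpa [Token.expand] using ih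

/-- The program that writes the number of a state. -/
def StateRef.tokens (A : Type) (r : StateRef) : List (Token A) :=
  (if r.relative then [Token.counter] else []) ++ (encodeNum A r.offset).map .sym

lemma StateRef.flatMap_expand_tokens (c : ℕ) (r : StateRef) :
    (r.tokens A).flatMap (Token.expand c) = encodeNum A (r.eval c) := by
  obtain ⟨b, k⟩ := r
  rw [tokens, List.flatMap_append, flatMap_expand_map_sym]
  cases b
  · simp [StateRef.eval]
  · simp [StateRef.eval, Token.expand, encodeNum, ← List.append_assoc]

/-- The program that writes a transition as an entry of a list. -/
def Template.tokens {m : ℕ} (t : Template A m) : List (Token A) :=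
  .sym .item :: (t.src.tokens A ++ (encodeRead t.read).map .sym ++
    (encodeStackOp A t.pop).map .sym ++ (encodeStackOp A t.push).map .sym ++ t.tgt.tokens A)

lemma Template.flatMap_expand_tokens {m N : ℕ} [NeZero N] (c : ℕ) (t : Template A m)
    (h : t.src.eval c < N ∧ t.tgt.eval c < N) :
    t.tokens.flatMap (Token.expand c) = .item :: encodeTransition (t.toTransition N c) := by
  simp only [tokens, List.flatMap_cons, List.flatMap_append, flatMap_expand_map_sym,
    StateRef.flatMap_expand_tokens, encodeTransition, toTransition, encodeFin, Fin.val_ofNat,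
    Nat.mod_eq_of_lt h.1, Nat.mod_eq_of_lt h.2]
  rfl

lemma flatMap_expand_templates {m N : ℕ} [NeZero N] (c : ℕ) (l : List (Template A m))
    (h : ∀ t ∈ l, t.src.eval c < N ∧ t.tgt.eval c < N) :
    (l.flatMap Template.tokens).flatMap (Token.expand c) =
      (l.map (Template.toTransition N c)).flatMap (fun t => .item :: encodeTransition t) := by
  rw [List.flatMap_assoc, List.flatMap_map]
  exact List.flatMap_congr fun t ht => t.flatMap_expand_tokens c (h t ht)

section Programs

variable [Fintype A]

/-- The program for the transitions of a symbol of the written keyboard. -/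
noncomputable def symProgram (b : Bool) (y : KeyboardSym A) : List (Token A) :=
  (symTemplates b y).flatMap Template.tokens

/-- The program for the end of the written automaton. -/
noncomputable def baseProgram (A : Type) [Fintype A] : List (Token A) :=
  (baseTemplates (A := A)).flatMap Template.tokens ++ [.sym .endList]

/-- The program for the beginning of the written automaton, up to its list of transitions. -/
noncomputable def headerProgram (A : Type) [Fintype A] : List (Token A) :=
  (StateRef.shifted 3).tokens A ++ (encodeNum A (Fintype.card A + 1) ++ encodeNum A 0 ++
    ([PDASym.item] ++ encodeNum A 0 ++ [PDASym.endList]) ++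
    ([PDASym.item] ++ encodeNum A 2 ++ [PDASym.endList])).map .sym

lemma encodePDA_undoPDA (x : KeyboardListing A) :
    encodePDA (undoPDA x) =
      (headerProgram A).flatMap (Token.expand ((encodeKeyboard x).length + 1)) ++
        ((symTransitions ((encodeKeyboard x).length + 4) false 1 (encodeKeyboard x)).flatMap
            (fun t => .item :: encodeTransition t) ++
          (baseProgram A).flatMap (Token.expand 0)) := by
  have hbase := flatMap_expand_templates (N := (encodeKeyboard x).length + 4) 0
    (baseTemplates (A := A)) fun t ht => by
      have := Template.eval_lt_of_mem_baseTemplates ht 0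
      omega
  -- The accepting state is a numeral in `Fin`, hence a remainder.
  have h2 : 2 % ((encodeKeyboard x).length + 4) = 2 := Nat.mod_eq_of_lt (by omega)
  rw [headerProgram, baseProgram, List.flatMap_append, List.flatMap_append,
    flatMap_expand_map_sym, StateRef.flatMap_expand_tokens, StateRef.eval_shifted, hbase]
  simp [encodePDA, undoPDA, undoTransitions, encodeList, encodeFin, Token.expand, h2]

end Programs

/-! ### The Turing machine that writes the automaton -/

/-- The stacks of the machine. `counter` and `spare` hold numbers in unary, and `program` holds
what remains to be written, last token on top. -/
inductive Stk where
  | input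
  | output
  | counter
  | spare
  | program
deriving DecidableEq

/-- The alphabets of the stacks. -/
abbrev StkSym (A : Type) : Stk → Type
  | .input => KeyboardSym A
  | .output => PDASym A
  | .counter => Unit
  | .spare => Unit
  | .program => Token A

/-- The labels of the machine. The argument `b` tells whether the separator has been read. The
argument `p` tells how to go on after the current program: with the next symbol for `some b`, with
clearing the counter for `none`. -/
inductive Lbl (A : Type) where
  | start
  | read (b : Bool)
  | load (b : Bool) (y : KeyboardSym A)
  | run (p : Option Bool)
  | emit (p : Option Bool) (a : PDASym A)
  | copy (p : Option Bool)
  | copyOne (p : Option Bool)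
  | restore (p : Option Bool)
  | restoreOne (p : Option Bool)
  | finish
  | clear
  | done

/-- Statements of the machine. The internal state always repeats the current label. -/
abbrev LblStmt (A : Type) := Turing.TM2.Stmt (StkSym A) (Lbl A) (Lbl A)

/-- Continue with the label `l`. -/
def jump (l : Lbl A) : LblStmt A := .load (fun _ => l) (.goto id)

/-- Pop a symbol and continue with a label that depends on it. -/
def popThen (k : Stk) (f : Option (StkSym A k) → Lbl A) : LblStmt A :=
  .pop k (fun _ o => f o) (.goto id)

/-- Push all symbols of a list, the first one first. -/
def pushAll (k : Stk) : List (StkSym A k) → LblStmt A → LblStmt A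
  | [], q => q
  | a :: l, q => .push k (fun _ => a) (pushAll k l q)

/-- The contents of the stacks. -/
def stackVals (inp : List (KeyboardSym A)) (out : List (PDASym A)) (c d : ℕ)
    (prog : List (Token A)) : ∀ k, List (StkSym A k)
  | .input => inp
  | .output => out
  | .counter => List.replicate c ()
  | .spare => List.replicate d ()
  | .program => prog

lemma update_stackVals_program (inp : List (KeyboardSym A)) (out : List (PDASym A)) (c d : ℕ)
    (prog prog' : List (Token A)) :
    Function.update (stackVals inp out c d prog) .program prog' = stackVals inp out c d prog' := by
  funext k; cases k <;> rfl

section Machine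

variable [Fintype A]

/-- The code of the machine. Each symbol of the input puts the program of its transitions on a
stack, and the programs are executed from their ends, so that the output appears in order. -/
noncomputable def code : Lbl A → LblStmt A
  | .start => pushAll .program (baseProgram A) (jump (.run (some false)))
  | .read b => .push .counter (fun _ => ()) (popThen .input fun
      | none => .finish
      | some y => .load b y)
  | .load b y => pushAll .program (symProgram b y) (jump (.run (some (b || y.isSep))))
  | .run p => popThen .program fun
      | none => match p with
        | some b => .read b
        | none => .clear
      | some (.sym a) => .emit p a
      | some .counter => .copy p
  | .emit p a => .push .output (fun _ => a) (jump (.run p))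
  | .copy p => popThen .counter fun
      | none => .restore p
      | some _ => .copyOne p
  | .copyOne p => .push .spare (fun _ => ()) (.push .output (fun _ => .one) (jump (.copy p)))
  | .restore p => popThen .spare fun
      | none => .run p
      | some _ => .restoreOne p
  | .restoreOne p => .push .counter (fun _ => ()) (jump (.restore p))
  | .finish => pushAll .program (headerProgram A) (jump (.run none))
  | .clear => popThen .counter fun
      | none => .done
      | some _ => .clear
  | .done => .load (fun _ => .start) .halt

end Machine

lemma stepAux_pushAll (l : List (Token A)) (q : LblStmt A) (v : Lbl A)
    (inp : List (KeyboardSym A)) (out : List (PDASym A)) (c d : ℕ) (prog : List (Token A)) :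
    Turing.TM2.stepAux (pushAll .program l q) v (stackVals inp out c d prog) =
      Turing.TM2.stepAux q v (stackVals inp out c d (l.reverse ++ prog)) := by
  induction l generalizing prog with
  | nil => rfl
  | cons a l ih =>
    rw [pushAll, Turing.TM2.stepAux, update_stackVals_program, ih]
    simp [stackVals]

section Simulation

open StateTransition

variable [Fintype A]

/-- The configuration with label `l` and the given contents of the stacks. -/
def conf (l : Lbl A) (inp : List (KeyboardSym A)) (out : List (PDASym A)) (c d : ℕ)
    (prog : List (Token A)) : Turing.TM2.Cfg (StkSym A) (Lbl A) (Lbl A) :=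
  ⟨some l, l, stackVals inp out c d prog⟩

/-- The machine gets from `a` to `b` in at most `n` steps. -/
def Within (n : ℕ) (a b : Turing.TM2.Cfg (StkSym A) (Lbl A) (Lbl A)) : Prop :=
  Nonempty (EvalsToInTime (Turing.TM2.step code) a (some b) n)

lemma Within.refl (a : Turing.TM2.Cfg (StkSym A) (Lbl A) (Lbl A)) : Within 0 a a :=
  ⟨EvalsToInTime.refl _ _⟩

lemma Within.trans {m n : ℕ} {a b c : Turing.TM2.Cfg (StkSym A) (Lbl A) (Lbl A)}
    (h₁ : Within m a b) (h₂ : Within n b c) : Within (m + n) a c := by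
  obtain ⟨h₁⟩ := h₁
  obtain ⟨h₂⟩ := h₂
  rw [Nat.add_comm]
  exact ⟨EvalsToInTime.trans _ _ _ _ _ _ h₁ h₂⟩

lemma Within.mono {m n : ℕ} {a b : Turing.TM2.Cfg (StkSym A) (Lbl A) (Lbl A)}
    (h : Within m a b) (hmn : m ≤ n) : Within n a b := by
  obtain ⟨h⟩ := h
  exact ⟨⟨h.toEvalsTo, h.steps_le_m.trans hmn⟩⟩

lemma Within.of_step {a b : Turing.TM2.Cfg (StkSym A) (Lbl A) (Lbl A)}
    (h : Turing.TM2.step code a = some b) : Within 1 a b :=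
  ⟨⟨⟨1, h⟩, le_rfl⟩⟩

variable (inp : List (KeyboardSym A)) (out : List (PDASym A)) (c d : ℕ) (prog : List (Token A))

/-! ### Single steps of the machine -/

lemma within_start : Within 1 (conf .start inp out c d prog)
    (conf (.run (some false)) inp out c d ((baseProgram A).reverse ++ prog)) :=
  .of_step (congrArg some (stepAux_pushAll _ _ _ _ _ _ _ _))

lemma within_load (b : Bool) (y : KeyboardSym A) : Within 1 (conf (.load b y) inp out c d prog)
    (conf (.run (some (b || y.isSep))) inp out c d ((symProgram b y).reverse ++ prog)) :=
  .of_step (congrArg some (stepAux_pushAll _ _ _ _ _ _ _ _))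

lemma within_finish : Within 1 (conf .finish inp out c d prog)
    (conf (.run none) inp out c d ((headerProgram A).reverse ++ prog)) :=
  .of_step (congrArg some (stepAux_pushAll _ _ _ _ _ _ _ _))

lemma within_read_nil (b : Bool) : Within 1 (conf (.read b) [] out c d prog)
    (conf .finish [] out (c + 1) d prog) :=
  .of_step (congrArg some (congrArg (Turing.TM2.Cfg.mk _ _) (funext fun k => by cases k <;> rfl)))

lemma within_read_cons (b : Bool) (y : KeyboardSym A) :
    Within 1 (conf (.read b) (y :: inp) out c d prog) (conf (.load b y) inp out (c + 1) d prog) :=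
  .of_step (congrArg some (congrArg (Turing.TM2.Cfg.mk _ _) (funext fun k => by cases k <;> rfl)))

lemma within_run_nil_some (b : Bool) : Within 1 (conf (.run (some b)) inp out c d [])
    (conf (.read b) inp out c d []) :=
  .of_step (congrArg some (congrArg (Turing.TM2.Cfg.mk _ _) (funext fun k => by cases k <;> rfl)))

lemma within_run_nil_none : Within 1 (conf (.run none) inp out c d [])
    (conf .clear inp out c d []) :=
  .of_step (congrArg some (congrArg (Turing.TM2.Cfg.mk _ _) (funext fun k => by cases k <;> rfl)))

lemma within_run_sym (p : Option Bool) (a : PDASym A) :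
    Within 1 (conf (.run p) inp out c d (.sym a :: prog)) (conf (.emit p a) inp out c d prog) :=
  .of_step (congrArg some (congrArg (Turing.TM2.Cfg.mk _ _) (funext fun k => by cases k <;> rfl)))

lemma within_run_counter (p : Option Bool) :
    Within 1 (conf (.run p) inp out c d (.counter :: prog)) (conf (.copy p) inp out c d prog) :=
  .of_step (congrArg some (congrArg (Turing.TM2.Cfg.mk _ _) (funext fun k => by cases k <;> rfl)))

lemma within_emit (p : Option Bool) (a : PDASym A) :
    Within 1 (conf (.emit p a) inp out c d prog) (conf (.run p) inp (a :: out) c d prog) :=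
  .of_step (congrArg some (congrArg (Turing.TM2.Cfg.mk _ _) (funext fun k => by cases k <;> rfl)))

lemma within_copy_zero (p : Option Bool) :
    Within 1 (conf (.copy p) inp out 0 d prog) (conf (.restore p) inp out 0 d prog) :=
  .of_step (congrArg some (congrArg (Turing.TM2.Cfg.mk _ _) (funext fun k => by cases k <;> rfl)))

lemma within_copy_succ (p : Option Bool) :
    Within 1 (conf (.copy p) inp out (c + 1) d prog) (conf (.copyOne p) inp out c d prog) :=
  .of_step (congrArg some (congrArg (Turing.TM2.Cfg.mk _ _) (funext fun k => by cases k <;> rfl)))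

lemma within_copyOne (p : Option Bool) : Within 1 (conf (.copyOne p) inp out c d prog)
    (conf (.copy p) inp (.one :: out) c (d + 1) prog) :=
  .of_step (congrArg some (congrArg (Turing.TM2.Cfg.mk _ _) (funext fun k => by cases k <;> rfl)))

lemma within_restore_zero (p : Option Bool) :
    Within 1 (conf (.restore p) inp out c 0 prog) (conf (.run p) inp out c 0 prog) :=
  .of_step (congrArg some (congrArg (Turing.TM2.Cfg.mk _ _) (funext fun k => by cases k <;> rfl)))

lemma within_restore_succ (p : Option Bool) :
    Within 1 (conf (.restore p) inp out c (d + 1) prog) (conf (.restoreOne p) inp out c d prog) :=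
  .of_step (congrArg some (congrArg (Turing.TM2.Cfg.mk _ _) (funext fun k => by cases k <;> rfl)))

lemma within_restoreOne (p : Option Bool) :
    Within 1 (conf (.restoreOne p) inp out c d prog) (conf (.restore p) inp out (c + 1) d prog) :=
  .of_step (congrArg some (congrArg (Turing.TM2.Cfg.mk _ _) (funext fun k => by cases k <;> rfl)))

lemma within_clear_zero : Within 1 (conf .clear inp out 0 d prog) (conf .done inp out 0 d prog) :=
  .of_step (congrArg some (congrArg (Turing.TM2.Cfg.mk _ _) (funext fun k => by cases k <;> rfl)))

lemma within_clear_succ :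
    Within 1 (conf .clear inp out (c + 1) d prog) (conf .clear inp out c d prog) :=
  .of_step (congrArg some (congrArg (Turing.TM2.Cfg.mk _ _) (funext fun k => by cases k <;> rfl)))

lemma within_done : Within 1 (conf .done inp out c d prog)
    ⟨none, .start, stackVals inp out c d prog⟩ :=
  .of_step rfl

/-! ### Loops of the machine -/

/-- Copying moves the counter to `spare`, and writes a one for each unit. -/
lemma within_copy (p : Option Bool) :
    Within (2 * c + 1) (conf (.copy p) inp out c d prog)
      (conf (.restore p) inp (List.replicate c .one ++ out) 0 (c + d) prog) := by
  induction c generalizing out d with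
  | zero => simpa using within_copy_zero inp out d prog p
  | succ c ih =>
    have h := ((within_copy_succ inp out c d prog p).trans
      (within_copyOne inp out c d prog p)).trans (ih (.one :: out) (d + 1))
    have e : List.replicate c PDASym.one ++ .one :: out =
        List.replicate (c + 1) .one ++ out := by
      rw [List.replicate_succ', List.append_assoc, List.singleton_append]
    rw [e, show c + (d + 1) = c + 1 + d by omega] at h
    exact h.mono (by omega)

lemma within_restore (p : Option Bool) :
    Within (2 * d + 1) (conf (.restore p) inp out c d prog)
      (conf (.run p) inp out (d + c) 0 prog) := by
  induction d generalizing c with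
  | zero => simpa using within_restore_zero inp out c prog p
  | succ d ih =>
    have h := ((within_restore_succ inp out c d prog p).trans
      (within_restoreOne inp out c d prog p)).trans (ih (c + 1))
    rw [show d + (c + 1) = d + 1 + c by omega] at h
    exact h.mono (by omega)

lemma within_clear : Within (c + 1) (conf .clear inp out c 0 [])
    (conf .done inp out 0 0 []) := by
  induction c with
  | zero => exact within_clear_zero inp out 0 []
  | succ c ih => exact ((within_clear_succ inp out c 0 []).trans ih).mono (by omega)

/-- Executing a program writes its expansion and leaves the counter unchanged. -/
lemma within_run (p : Option Bool) (l : List (Token A)) :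
    Within (l.length * (4 * c + 3)) (conf (.run p) inp out c 0 l.reverse)
      (conf (.run p) inp (l.flatMap (Token.expand c) ++ out) c 0 []) := by
  induction l using List.reverseRecOn generalizing out with
  | nil => simpa using Within.refl _
  | append_singleton l a ih =>
    have h : Within (4 * c + 3) (conf (.run p) inp out c 0 (l ++ [a]).reverse)
        (conf (.run p) inp (a.expand c ++ out) c 0 l.reverse) := by
      rw [List.reverse_concat]
      cases a with
      | sym a =>
        exact ((within_run_sym inp out c 0 _ p a).trans (within_emit inp out c 0 _ p a)).mono
          (by omega)
      | counter =>
        exact (((within_run_counter inp out c 0 _ p).trans (within_copy inp out c 0 _ p)).trans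
          (within_restore inp _ 0 c _ p)).mono (by omega)
    have h' := h.trans (ih (a.expand c ++ out))
    have e : (l ++ [a]).flatMap (Token.expand c) = l.flatMap (Token.expand c) ++ a.expand c := by
      simp
    rw [e, List.append_assoc]
    exact h'.mono (by rw [List.length_append, List.length_singleton]; linarith)

lemma flatMap_expand_symProgram {N : ℕ} [NeZero N] (b : Bool) (y : KeyboardSym A)
    (h : c + 4 ≤ N) :
    (symProgram b y).flatMap (Token.expand c) =
      ((symTemplates b y).map (Template.toTransition N c)).flatMap
        (fun t => .item :: encodeTransition t) :=
  flatMap_expand_templates c _ fun t ht => by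
    have := Template.eval_lt_of_mem_symTemplates ht c
    omega

/-- The main loop: all symbols of the input are read, and their transitions are written. -/
lemma within_read {N L M : ℕ} [NeZero N] (hL : ∀ b (y : KeyboardSym A), (symProgram b y).length ≤ L)
    (b : Bool) (hN : c + inp.length + 4 ≤ N) (hM : c + inp.length ≤ M) :
    Within (inp.length * (L * (4 * M + 3) + 3) + 1) (conf (.read b) inp out c 0 [])
      (conf .finish [] ((symTransitions N b (c + 1) inp).flatMap
        (fun t => .item :: encodeTransition t) ++ out) (c + inp.length + 1) 0 []) := by
  induction inp generalizing b c out with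
  | nil => simpa [symTransitions] using within_read_nil out c 0 [] b
  | cons y s ih =>
    rw [List.length_cons] at hN hM ⊢
    have h₁ := (within_read_cons s out c 0 [] b y).trans (within_load s out (c + 1) 0 [] b y)
    rw [List.append_nil] at h₁
    have h₂ := (within_run s out (c + 1) (some (b || y.isSep)) (symProgram b y)).trans
      (within_run_nil_some s _ (c + 1) 0 _)
    have h₃ := (h₁.trans h₂).trans (ih _ (c + 1) (b || y.isSep) (by omega) (by omega))
    rw [flatMap_expand_symProgram (N := N) (c + 1) b y (by omega), ← List.append_assoc,
      ← List.flatMap_append] at h₃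
    rw [symTransitions, show c + (s.length + 1) + 1 = c + 1 + s.length + 1 by omega]
    refine h₃.mono ?_
    have hp : (symProgram b y).length * (4 * (c + 1) + 3) ≤ L * (4 * M + 3) :=
      Nat.mul_le_mul (hL b y) (by omega)
    have : (s.length + 1) * (L * (4 * M + 3) + 3) =
      s.length * (L * (4 * M + 3) + 3) + (L * (4 * M + 3) + 3) := by ring
    omega

/-- The whole computation of the machine. -/
lemma within_code {L : ℕ} (hL : ∀ b (y : KeyboardSym A), (symProgram b y).length ≤ L)
    (hbase : (baseProgram A).length ≤ L) (hheader : (headerProgram A).length ≤ L)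
    (x : KeyboardListing A) {n : ℕ} (hn : (encodeKeyboard x).length = n) :
    Within ((n + 2) * (L * (4 * n + 7) + 3) + n + 6) (conf .start (encodeKeyboard x) [] 0 0 [])
      ⟨none, .start, stackVals [] (encodePDA (undoPDA x)) 0 0 []⟩ := by
  have h₁ := within_start (encodeKeyboard x) [] 0 0 []
  rw [List.append_nil] at h₁
  have h₂ := (h₁.trans (within_run (encodeKeyboard x) [] 0 _ _)).trans
    (within_run_nil_some _ _ 0 0 false)
  have h₃ := h₂.trans (within_read (N := (encodeKeyboard x).length + 4) (M := n + 1)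
    (encodeKeyboard x) _ 0 hL false (by omega) (by omega))
  have h₄ := h₃.trans (within_finish _ _ _ 0 [])
  simp only [List.append_nil] at h₄
  have h₅ := ((h₄.trans (within_run _ _ _ _ _)).trans (within_run_nil_none _ _ _ 0)).trans
    ((within_clear _ _ _).trans (within_done _ _ _ _ _))
  simp only [Nat.zero_add] at h₅
  rw [← encodePDA_undoPDA] at h₅
  refine h₅.mono ?_
  rw [hn]
  have hb : (baseProgram A).length * (4 * 0 + 3) ≤ L * (4 * n + 7) :=
    Nat.mul_le_mul hbase (by omega)
  have hh : (headerProgram A).length * (4 * (n + 1) + 3) ≤ L * (4 * n + 7) :=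
    Nat.mul_le_mul hheader (by omega)
  have e : 4 * (n + 1) + 3 = 4 * n + 7 := by omega
  rw [e] at hh ⊢
  have : (n + 2) * (L * (4 * n + 7) + 3) = n * (L * (4 * n + 7) + 3) +
    2 * (L * (4 * n + 7)) + 6 := by ring
  omega

/-! ### Finiteness of the machine -/

instance instFiniteKeyboardSym : Finite (KeyboardSym A) := by
  let f : Option (Option (Option (Option (Option A)))) → KeyboardSym A
    | none => .endKey
    | some none => .sep
    | some (some none) => .op .backspace
    | some (some (some none)) => .op .left
    | some (some (some (some none))) => .op .right
    | some (some (some (some (some a)))) => .op (.write a)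
  refine Finite.of_surjective f ?_
  rintro ((a | - | - | -) | - | -)
  exacts [⟨some (some (some (some (some a)))), rfl⟩, ⟨some (some none), rfl⟩,
    ⟨some (some (some none)), rfl⟩, ⟨some (some (some (some none))), rfl⟩, ⟨none, rfl⟩,
    ⟨some none, rfl⟩]

instance instFinitePDASym : Finite (PDASym A) := by
  let f : A ⊕ Fin 5 → PDASym A
    | .inl a => .letter a
    | .inr 0 => .one
    | .inr 1 => .endNum
    | .inr 2 => .blank
    | .inr 3 => .item
    | .inr 4 => .endList
  refine Finite.of_surjective f ?_
  rintro (a | - | - | - | - | -)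
  exacts [⟨.inl a, rfl⟩, ⟨.inr 0, rfl⟩, ⟨.inr 1, rfl⟩, ⟨.inr 2, rfl⟩, ⟨.inr 3, rfl⟩, ⟨.inr 4, rfl⟩]

instance instFiniteLbl : Finite (Lbl A) := by
  let f : (Fin 4 ⊕ Bool) ⊕ (Bool × KeyboardSym A) ⊕ (Option Bool × PDASym A) ⊕
      (Fin 5 × Option Bool) → Lbl A
    | .inl (.inl 0) => .start
    | .inl (.inl 1) => .finish
    | .inl (.inl 2) => .clear
    | .inl (.inl 3) => .done
    | .inl (.inr b) => .read b
    | .inr (.inl (b, y)) => .load b y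
    | .inr (.inr (.inl (p, a))) => .emit p a
    | .inr (.inr (.inr (0, p))) => .run p
    | .inr (.inr (.inr (1, p))) => .copy p
    | .inr (.inr (.inr (2, p))) => .copyOne p
    | .inr (.inr (.inr (3, p))) => .restore p
    | .inr (.inr (.inr (4, p))) => .restoreOne p
  refine Finite.of_surjective f ?_
  rintro (- | b | ⟨b, y⟩ | p | ⟨p, a⟩ | p | p | p | p | - | - | -)
  exacts [⟨.inl (.inl 0), rfl⟩, ⟨.inl (.inr b), rfl⟩, ⟨.inr (.inl (b, y)), rfl⟩,
    ⟨.inr (.inr (.inr (0, p))), rfl⟩, ⟨.inr (.inr (.inl (p, a))), rfl⟩,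
    ⟨.inr (.inr (.inr (1, p))), rfl⟩, ⟨.inr (.inr (.inr (2, p))), rfl⟩,
    ⟨.inr (.inr (.inr (3, p))), rfl⟩, ⟨.inr (.inr (.inr (4, p))), rfl⟩,
    ⟨.inl (.inl 1), rfl⟩, ⟨.inl (.inl 2), rfl⟩, ⟨.inl (.inl 3), rfl⟩]

lemma exists_program_length_le (A : Type) [Fintype A] :
    ∃ L, (∀ b (y : KeyboardSym A), (symProgram b y).length ≤ L) ∧
      (baseProgram A).length ≤ L ∧ (headerProgram A).length ≤ L := by
  obtain ⟨L, hL⟩ := (Set.finite_range fun z : Bool × KeyboardSym A =>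
    (symProgram z.1 z.2).length).bddAbove
  exact ⟨max L (max (baseProgram A).length (headerProgram A).length),
    fun b y => (hL ⟨(b, y), rfl⟩).trans (le_max_left _ _), by simp, by simp⟩

/-- The Turing machine that writes `undoPDA x`, given `x`. -/
noncomputable def undoMachine (A : Type) [Fintype A] : Turing.FinTM2 where
  K := Stk
  kFin := ⟨{.input, .output, .counter, .spare, .program}, fun k => by cases k <;> simp⟩
  k₀ := .input
  k₁ := .output
  Γ := StkSym A
  Λ := Lbl A
  main := .start
  ΛFin := Fintype.ofFinite _
  σ := Lbl A
  initialState := .start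
  σFin := Fintype.ofFinite _
  Γk₀Fin := Fintype.ofFinite (KeyboardSym A)
  m := code

lemma initList_undoMachine (s : List (KeyboardSym A)) :
    Turing.initList (undoMachine A) s = conf .start s [] 0 0 [] :=
  congrArg (Turing.TM2.Cfg.mk _ _) (funext fun k => by cases k <;> rfl)

lemma haltList_undoMachine (s : List (PDASym A)) :
    Turing.haltList (undoMachine A) s = ⟨none, .start, stackVals [] s 0 0 []⟩ :=
  congrArg (Turing.TM2.Cfg.mk _ _) (funext fun k => by cases k <;> rfl)

theorem nonempty_polyTime_undoPDA (A : Type) [Fintype A] :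
    Nonempty (Turing.TM2ComputableInPolyTime (encodeKeyboard (A := A)) encodePDA undoPDA) := by
  obtain ⟨L, hL, hbase, hheader⟩ := exists_program_length_le A
  refine ⟨{
    tm := undoMachine A
    inputAlphabet := Equiv.refl _
    outputAlphabet := Equiv.refl _
    time := (.X + 2) * (.C L * (4 * .X + 7) + 3) + .X + 6
    outputsFun := fun x => Classical.choice ?_ }⟩
  obtain ⟨⟨⟨k, hk⟩, hle⟩⟩ := within_code hL hbase hheader x rfl
  have hin : Turing.initList (undoMachine A)
      ((encodeKeyboard x).map (Equiv.refl (KeyboardSym A)).invFun) = _ :=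
    (congrArg _ (List.map_id _)).trans (initList_undoMachine (encodeKeyboard x))
  have hout : Turing.haltList (undoMachine A)
      ((encodePDA (undoPDA x)).map (Equiv.refl (PDASym A)).invFun) = _ :=
    (congrArg _ (List.map_id _)).trans (haltList_undoMachine (encodePDA (undoPDA x)))
  refine ⟨⟨⟨k, ?_⟩, by simpa using hle⟩⟩
  exact (congrArg _ (congrArg some hin)).trans (hk.trans (congrArg some hout.symm))

end Simulation

end KeyboardLang

theorem mainTheorem2 (A : Type) [Fintype A] :
    (∀ K : KeyboardLang.Keyboard A, K.IsBLEK → K.language.IsContextFree) ∧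
    ∃ build : KeyboardLang.KeyboardListing A → KeyboardLang.PDA A,
      Nonempty (Turing.TM2ComputableInPolyTime
        KeyboardLang.encodeKeyboard KeyboardLang.encodePDA build) ∧
      ∀ K : KeyboardLang.Keyboard A, K.IsBLEK →
        ∀ x : KeyboardLang.KeyboardListing A, x.Lists K → (build x).language = K.language :=
  ⟨fun _ hK => hK.isContextFree_language, KeyboardLang.undoPDA,
    KeyboardLang.nonempty_polyTime_undoPDA A,
    fun _ hK _ hx => KeyboardLang.language_undoPDA hK hx⟩
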